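/- Let $\mathbb{D}$ be the open unit disk, let $H^2$ be the Hardy space of analytic functions $f$ on $\mathbb{D}$ with norm $\|f\|=\sup_{0<r<1}\big(\int_{\mathbb{T}}|f(r\xi)|^2\,dm(\xi)\big)^{1/2}<\infty$ ($m$ is normalized Lebesgue measure on the unit circle $\mathbb{T}$), and let $$(Cf)(z)=\frac1z\int_0^z\frac{f(\xi)}{1-\xi}\,d\xi$$ be the Cesàro operator on $H^2$. For $f\in H^2$ let $(Kf)(w)=\langle f,q_{\overline{w}}\rangle_{H^2}$, $w\in\mathbb{D}$, where $q_w(z)=(1-z)^{w/(1-w)}$ (principal branch), and let $\|Kf\|_{\mathcal{H}}=\|f\|_{H^2}$. Let $\mu$ be the Kriete–Trutt measure, that is, the finite positive Borel measure on $\overline{\mathbb{D}}$ with $\int|p|^2\,d\mu=\|p\|_{\mathcal{H}}^2$ for all polynomials $p\in\mathbb{C}[z]$. Explicitly, $\mu=\sum_{n\ge0}\mu_n$, where $\mu_n$ is the image of the measure $\frac{1}{2\pi\,n!}\left|\Gamma\!\left(\frac{n+1}{2}+it\right)\right|^2dt$ on $\mathbb{R}$ under the map $t\mapsto \frac{s}{1+s}$,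 $s=\frac{n-1}{2}+it$; it lives on the circle with centre $\frac{n}{n+1}$ and radius $\frac1{n+1}$. Let $\mathcal{H}^2(\mu)$ be the closure of $\mathbb{C}[z]$ in $L^2(\mu)$. Then: 1. If $\mathcal{M}\subset H^2$ is a closed subspace with $C\mathcal{M}\subset\mathcal{M}$, then $C\mathcal{M}$ is dense in $\mathcal{M}$. 2. If $\mathcal{N}\subset\mathcal{H}^2(\mu)$ is a closed subspace with $z\mathcal{N}\subset\mathcal{N}$, then $(1-z)\mathcal{N}$ is dense in $\mathcal{N}$. Here 2 is asserted both for the explicit measure above and for every finite positive Borel measure on $\overline{\mathbb{D}}$ with the stated norm property. -/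

import Mathlib

open MeasureTheory

noncomputable section

namespace Cesaro

/-- The open unit disk `{z : |z| < 1}`. -/
abbrev disk : Set ℂ := Metric.ball 0 1

/-! ### The Hardy space of the disk -/

/-- The `L²` norm, with respect to normalized Lebesgue measure on the unit circle, of
`ξ ↦ f (r ξ)`. -/
def circleMean (f : ℂ → ℂ) (r : ℝ) : ENNReal :=
  eLpNorm (fun θ : UnitAddCircle => f ((r : ℂ) * (AddCircle.toCircle θ : ℂ))) 2
    AddCircle.haarAddCircle

/-- The extended Hardy norm `sup_{0 < r < 1} (∫ |f (r ξ)|² dm(ξ))^{1/2}`. -/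
def hardyENorm (f : ℂ → ℂ) : ENNReal :=
  ⨆ r ∈ Set.Ioo (0 : ℝ) 1, circleMean f r

theorem circle_mem_disk {r : ℝ} (hr : r ∈ Set.Ioo (0 : ℝ) 1) (θ : UnitAddCircle) :
    (r : ℂ) * (AddCircle.toCircle θ : ℂ) ∈ disk := by
  have h : ‖(AddCircle.toCircle θ : ℂ)‖ = 1 := Circle.norm_coe _
  rw [mem_ball_zero_iff, norm_mul, h, mul_one, Complex.norm_real, Real.norm_of_nonneg hr.1.le]
  exact hr.2

theorem continuous_circle {f : ℂ → ℂ} (hf : DifferentiableOn ℂ f disk) {r : ℝ}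
    (hr : r ∈ Set.Ioo (0 : ℝ) 1) :
    Continuous fun θ : UnitAddCircle => f ((r : ℂ) * (AddCircle.toCircle θ : ℂ)) := by
  refine hf.continuousOn.comp_continuous ?_ (circle_mem_disk hr)
  exact continuous_const.mul (continuous_subtype_val.comp AddCircle.continuous_toCircle)

theorem hardyENorm_add_le {f g : ℂ → ℂ} (hf : DifferentiableOn ℂ f disk)
    (hg : DifferentiableOn ℂ g disk) :
    hardyENorm (f + g) ≤ hardyENorm f + hardyENorm g := by
  refine iSup₂_le fun r hr => ?_
  refine (eLpNorm_add_le (continuous_circle hf hr).aestronglyMeasurable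
    (continuous_circle hg hr).aestronglyMeasurable (by norm_num)).trans ?_
  exact add_le_add (le_iSup₂ (f := fun r _ => circleMean f r) r hr)
    (le_iSup₂ (f := fun r _ => circleMean g r) r hr)

theorem hardyENorm_smul (c : ℂ) (f : ℂ → ℂ) :
    hardyENorm (c • f) = ‖c‖ₑ * hardyENorm f := by
  simp only [hardyENorm, ENNReal.mul_iSup]
  refine iSup_congr fun r => iSup_congr fun _ => ?_
  exact eLpNorm_const_smul c _ _ _

theorem hardyENorm_zero : hardyENorm 0 = 0 := by
  simp [hardyENorm, circleMean]

/-- The functions that are analytic on the disk with finite Hardy norm, extended by zero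
outside of the disk, so that two of them are equal if and only if they agree on the disk. -/
def hardySubmodule : Submodule ℂ (ℂ → ℂ) where
  carrier := {f | DifferentiableOn ℂ f disk ∧ (∀ z, z ∉ disk → f z = 0) ∧ hardyENorm f < ⊤}
  zero_mem' := ⟨differentiableOn_const 0, fun _ _ => rfl, by simp [hardyENorm_zero]⟩
  add_mem' := by
    rintro f g ⟨hf, hf0, hfn⟩ ⟨hg, hg0, hgn⟩
    exact ⟨hf.add hg, fun z hz => by simp [hf0 z hz, hg0 z hz],
      (hardyENorm_add_le hf hg).trans_lt (ENNReal.add_lt_top.2 ⟨hfn, hgn⟩)⟩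
  smul_mem' := by
    rintro c f ⟨hf, hf0, hfn⟩
    refine ⟨hf.const_smul c, fun z hz => by simp [hf0 z hz], ?_⟩
    rw [hardyENorm_smul]
    exact ENNReal.mul_lt_top enorm_lt_top hfn

/-- The Hardy space `H²` of the unit disk. -/
def H2 : Type := hardySubmodule

instance : AddCommGroup H2 := inferInstanceAs (AddCommGroup hardySubmodule)

instance : Module ℂ H2 := inferInstanceAs (Module ℂ hardySubmodule)

/-- An element of `H²` as a function. -/
def H2.toFun (f : H2) : ℂ → ℂ := f.1

instance : CoeFun H2 fun _ => ℂ → ℂ := ⟨H2.toFun⟩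

theorem eq_zero_of_hardyENorm_eq_zero {f : ℂ → ℂ} (hf : f ∈ hardySubmodule)
    (h : hardyENorm f = 0) : f = 0 := by
  obtain ⟨hd, h0, -⟩ := hf
  have key : ∀ z ∈ disk, z ≠ 0 → f z = 0 := by
    intro z hz hz0
    have hr : ‖z‖ ∈ Set.Ioo (0 : ℝ) 1 := ⟨norm_pos_iff.2 hz0, by simpa using hz⟩
    have h1 : circleMean f ‖z‖ = 0 :=
      le_antisymm (h ▸ le_iSup₂ (f := fun r _ => circleMean f r) ‖z‖ hr) (zero_le)
    have hc := continuous_circle hd hr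
    rw [circleMean, eLpNorm_eq_zero_iff hc.aestronglyMeasurable (by norm_num)] at h1
    have h2 := (Continuous.ae_eq_iff_eq _ hc continuous_const).1 h1
    have hT : (1 : ℝ) ≠ 0 := one_ne_zero
    obtain ⟨θ, hθ⟩ := (AddCircle.homeomorphCircle hT).surjective
      ⟨z / ‖z‖, by simp [Submonoid.unitSphere, hz0]⟩
    have h3 := congrFun h2 θ
    rw [AddCircle.homeomorphCircle_apply] at hθ
    rw [hθ] at h3
    have h4 : (‖z‖ : ℂ) ≠ 0 := by simpa using hz0
    have h5 : (‖z‖ : ℂ) * (z / ‖z‖) = z := mul_div_cancel₀ _ h4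
    change f ((‖z‖ : ℂ) * (z / ‖z‖)) = 0 at h3
    rwa [h5] at h3
  have hzero : f 0 = 0 := by
    have hcont : ContinuousAt f 0 :=
      (hd.differentiableAt (Metric.ball_mem_nhds 0 one_pos)).continuousAt
    have h5 : Filter.Tendsto f (nhdsWithin 0 {0}ᶜ) (nhds (f 0)) :=
      hcont.tendsto.mono_left nhdsWithin_le_nhds
    have h6 : f =ᶠ[nhdsWithin 0 {0}ᶜ] fun _ => 0 := by
      filter_upwards [self_mem_nhdsWithin,
        mem_nhdsWithin_of_mem_nhds (Metric.ball_mem_nhds (0 : ℂ) one_pos)] with z hz hz'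
      exact key z hz' hz
    exact tendsto_nhds_unique h5 (tendsto_const_nhds.congr' h6.symm)
  funext z
  by_cases hz : z ∈ disk
  · by_cases hz0 : z = 0
    · simpa [hz0] using hzero
    · exact key z hz hz0
  · exact h0 z hz

/-- The Hardy norm `‖f‖ = (sup_{0 < r < 1} ∫ |f (r ξ)|² dm(ξ))^{1/2}` as a norm on `H²`. -/
def hardyNorm : AddGroupNorm H2 where
  toFun f := (hardyENorm f).toReal
  map_zero' := by
    change (hardyENorm 0).toReal = 0
    simp [hardyENorm_zero]
  add_le' f g := by
    have hf := f.2
    have hg := g.2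
    change (hardyENorm (f.1 + g.1)).toReal ≤ (hardyENorm f.1).toReal + (hardyENorm g.1).toReal
    rw [← ENNReal.toReal_add hf.2.2.ne hg.2.2.ne]
    exact ENNReal.toReal_mono (ENNReal.add_ne_top.2 ⟨hf.2.2.ne, hg.2.2.ne⟩)
      (hardyENorm_add_le hf.1 hg.1)
  neg' f := by
    have h := hardyENorm_smul (-1) f
    simp only [neg_smul, one_smul, enorm_neg, enorm_one, one_mul] at h
    exact congrArg ENNReal.toReal h
  eq_zero_of_map_eq_zero' f hf := by
    rcases (ENNReal.toReal_eq_zero_iff _).1 hf with h | h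
    · exact Subtype.ext (eq_zero_of_hardyENorm_eq_zero f.2 h)
    · exact absurd h f.2.2.2.ne

instance : NormedAddCommGroup H2 := hardyNorm.toNormedAddCommGroup

theorem H2.norm_def (f : H2) : ‖f‖ = (hardyENorm f).toReal := rfl

instance : NormedSpace ℂ H2 where
  norm_smul_le c f := by
    have h := hardyENorm_smul c f
    have h' : ‖c • f‖ = (hardyENorm (c • (f : ℂ → ℂ))).toReal := rfl
    rw [h', h, ENNReal.toReal_mul, toReal_enorm, H2.norm_def]

/-- The Cesàro operator `(C f)(z) = (1 / z) ∫₀ᶻ f(ξ) / (1 - ξ) dξ` at a point `z ≠ 0`, the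
integral being taken along the segment from `0` to `z`, and at `z = 0` the value `f 0` that
makes `C f` continuous there; in both cases this is `∫₀¹ f(t z) / (1 - t z) dt`. -/
def cesaro (f : ℂ → ℂ) (z : ℂ) : ℂ :=
  if z = 0 then f 0 else z⁻¹ * ∫ t in (0 : ℝ)..1, z * (f (t * z) / (1 - t * z))

/-- `C S = {C f : f ∈ S}`, as a subset of `H²`. -/
def cesaroImage (S : Set H2) : Set H2 :=
  {g | ∃ f ∈ S, ∀ z ∈ disk, g z = cesaro f z}

/-! ### The Kriete–Trutt transform and the Kriete–Trutt measure -/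

/-- The `n`-th Taylor coefficient at the origin. -/
def taylorCoeff (f : ℂ → ℂ) (n : ℕ) : ℂ := iteratedDeriv n f 0 / (n.factorial : ℂ)

/-- The inner product `⟨f, g⟩` of `H²`, linear in the first variable, in terms of Taylor
coefficients. -/
def hardyInner (f g : ℂ → ℂ) : ℂ :=
  ∑' n, taylorCoeff f n * (starRingEnd ℂ) (taylorCoeff g n)

/-- `q_w(z) = (1 - z) ^ (w / (1 - w))`, with the principal branch. -/
def q (w z : ℂ) : ℂ := (1 - z) ^ (w / (1 - w))

/-- The Kriete–Trutt transform `(K f)(w) = ⟨f, q_{w̄}⟩`. -/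
def ktTransform (f : ℂ → ℂ) (w : ℂ) : ℂ := hardyInner f (q ((starRingEnd ℂ) w))

/-- `μ` is a finite positive Borel measure on the closed disk with `∫ |p|² dμ = ‖p‖²` for all
polynomials `p`, where the norm on the right is the range norm `‖K f‖ = ‖f‖` of the
Kriete–Trutt space `{K f : f ∈ H²}`. -/
structure IsKrieteTruttMeasure (μ : Measure ℂ) : Prop where
  finite : IsFiniteMeasure μ
  support : μ (Metric.closedBall 0 1)ᶜ = 0
  norm_eq : ∀ (p : Polynomial ℂ) (f : H2), (∀ w ∈ disk, ktTransform f w = p.eval w) →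
    ∫ z, ‖p.eval z‖ ^ 2 ∂μ = ‖f‖ ^ 2

/-- The Kriete–Trutt measure in explicit form. The vertical line `s = (n - 1) / 2 + i t` is
mapped by `s ↦ s / (1 + s)` onto the circle with centre `n / (n + 1)` and radius `1 / (n + 1)`
without the point `1`; that circle carries the image of the measure
`|Γ((n + 1) / 2 + i t)|² / (2 π n!) dt`, whose total mass is `2 ^ (-n - 1)`. -/
def krieteTruttMeasure : Measure ℂ :=
  Measure.sum fun n : ℕ =>
    ((volume : Measure ℝ).withDensity fun t => ENNReal.ofReal
      (‖Complex.Gamma (((n : ℂ) + 1) / 2 + t * Complex.I)‖ ^ 2 /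
        (2 * Real.pi * n.factorial))).map
      fun t : ℝ =>
        (((n : ℂ) - 1) / 2 + t * Complex.I) / (1 + (((n : ℂ) - 1) / 2 + t * Complex.I))

/-- The classes in `L²(μ)` of the analytic polynomials. -/
def polynomialClasses (μ : Measure ℂ) : Submodule ℂ (Lp ℂ 2 μ) where
  carrier := {g | ∃ p : Polynomial ℂ, g =ᵐ[μ] fun z => p.eval z}
  zero_mem' := by
    refine ⟨0, ?_⟩
    filter_upwards [Lp.coeFn_zero ℂ 2 μ] with z h
    rw [h]
    simp
  add_mem' := by
    rintro f g ⟨p, hp⟩ ⟨r, hr⟩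
    refine ⟨p + r, ?_⟩
    filter_upwards [Lp.coeFn_add f g, hp, hr] with z h1 h2 h3
    rw [h1, Pi.add_apply, h2, h3, Polynomial.eval_add]
  smul_mem' := by
    rintro c f ⟨p, hp⟩
    refine ⟨c • p, ?_⟩
    filter_upwards [Lp.coeFn_smul c f, hp] with z h1 h2
    rw [h1, Pi.smul_apply, h2, Polynomial.eval_smul]

/-- `H²(μ)`, the closure of the analytic polynomials in `L²(μ)`. -/
def polyH2 (μ : Measure ℂ) : Submodule ℂ (Lp ℂ 2 μ) :=
  (polynomialClasses μ).topologicalClosure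

/-- `φ S = {φ f : f ∈ S}`, as a subset of `L²(μ)`. -/
def mulImage (μ : Measure ℂ) (φ : ℂ → ℂ) (S : Set (Lp ℂ 2 μ)) : Set (Lp ℂ 2 μ) :=
  {g | ∃ f ∈ S, g =ᵐ[μ] fun z => φ z * f z}

/-- `N` is a closed subspace of `H²(μ)` that is invariant under multiplication by `z`. -/
structure IsClosedShiftInvariant (μ : Measure ℂ) (N : Submodule ℂ (Lp ℂ 2 μ)) : Prop where
  le : N ≤ polyH2 μ
  closed : IsClosed (N : Set (Lp ℂ 2 μ))
  shift : ∀ f ∈ N, ∃ g ∈ N, g =ᵐ[μ] fun z => z * f z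

end Cesaro

end

open MeasureTheory

noncomputable section

namespace Cesaro

/-! Both halves follow from one Hilbert space fact. Let `1 - A` be a contraction and `M` a closed
`A`-invariant subspace. If `z` in `M` is orthogonal to `A M`, then `A z ⊥ z`, so `‖z‖² + ‖A z‖² = ‖z
- A z‖² ≤ ‖z‖²` and `A z = 0`. Injectivity of `A` then leaves no room between the closure of `A M`
and `M`.

For the Cesàro operator, Taylor coefficients turn `H²` into `ℓ²` and `C` into the averaging
operator, which is injective. That `1 - C` is a contraction is a telescoping estimate
(`norm_sq_sub_mean_le`).

For multiplication by `1 - z` on `L²(μ)`, `1 - A` is multiplication by `z`, a contraction on the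
closed disk. Injectivity amounts to `μ {1} = 0`. For the explicit measure this holds because `s / (1
+ s)` never equals `1`. For an abstract measure, `μ {1} ≤ ∫ |p|² dμ = ‖f‖²` whenever `K f = p` and
`p(1) = 1`, so small such `f` are needed. The transform carries `C` to multiplication by `1 - w`
(`seqTransform_seqCesaro`). The density result for `C`, applied to the closure of the sequences with
polynomial transform, approximates `1` by some `(1 - w) p`; the difference `1 - (1 - w) p` equals
`1` at `1` and has small norm. -/

/-- If `1 - A` is a contraction of a Hilbert space and `A` is injective on the closed invariant
subspace `M`, then `A M` is dense in `M`. -/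
theorem closure_image_eq_of_norm_sub_le {H : Type*} [NormedAddCommGroup H]
    [InnerProductSpace ℂ H] [CompleteSpace H] (A : H →ₗ[ℂ] H) (M : Submodule ℂ H)
    (hM : IsClosed (M : Set H)) (hinv : ∀ x ∈ M, A x ∈ M) (hle : ∀ x ∈ M, ‖x - A x‖ ≤ ‖x‖)
    (hker : ∀ x ∈ M, A x = 0 → x = 0) : closure (A '' (M : Set H)) = (M : Set H) := by
  set R : Submodule ℂ H := (M.map A).topologicalClosure with hR
  have hRM : R ≤ M := by
    refine Submodule.topologicalClosure_minimal _ ?_ hM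
    rintro _ ⟨x, hx, rfl⟩
    exact hinv x hx
  have hRc : (R : Set H) = closure (A '' (M : Set H)) := by
    rw [hR, Submodule.topologicalClosure_coe, Submodule.map_coe]
  have : CompleteSpace R := (Submodule.isClosed_topologicalClosure _).completeSpace_coe
  rw [← hRc]
  refine Set.Subset.antisymm hRM fun x hx => ?_
  obtain ⟨y, hy, z, hz, rfl⟩ := R.exists_add_mem_mem_orthogonal x
  have hzM : z ∈ M := by simpa using M.sub_mem hx (hRM hy)
  have hAz : A z ∈ R := Submodule.le_topologicalClosure _ ⟨z, hzM, rfl⟩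
  have h0 : inner ℂ (A z) z = 0 := hz _ hAz
  -- Equality case of Cauchy–Schwarz: `z - A z` is no longer than `z` and has inner product `‖z‖²`
  -- with it.
  have h1 : z - A z = z := by
    refine eq_of_norm_le_re_inner_eq_norm_sq (𝕜 := ℂ) (hle z hzM) ?_
    rw [inner_sub_left, h0, sub_zero, inner_self_eq_norm_sq]
  rw [hker z hzM (by simpa using h1), add_zero]
  exact hy

/-! ### Multiplication by `1 - z` on `L²(μ)` -/

theorem memLp_one_sub_mul {μ : Measure ℂ} (hμ : ∀ᵐ z ∂μ, ‖z‖ ≤ 1) (f : Lp ℂ 2 μ) :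
    MemLp (fun z => (1 - z) * f z) 2 μ := by
  refine (Lp.memLp f).of_le_mul (c := 2) ?_ ?_
  · exact (by fun_prop : Measurable fun z : ℂ => 1 - z).aestronglyMeasurable.mul
      (Lp.aestronglyMeasurable f)
  · filter_upwards [hμ] with z hz
    rw [norm_mul]
    gcongr
    calc ‖1 - z‖ ≤ ‖(1 : ℂ)‖ + ‖z‖ := norm_sub_le _ _
      _ ≤ 2 := by rw [norm_one]; linarith

/-- Multiplication by `1 - z` on `L²(μ)`, for a measure on the closed disk. -/
def mulOneSub {μ : Measure ℂ} (hμ : ∀ᵐ z ∂μ, ‖z‖ ≤ 1) : Lp ℂ 2 μ →ₗ[ℂ] Lp ℂ 2 μ where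
  toFun f := (memLp_one_sub_mul hμ f).toLp _
  map_add' f g := by
    rw [← MemLp.toLp_add]
    refine MemLp.toLp_congr _ _ ?_
    filter_upwards [Lp.coeFn_add f g] with z h
    simp only [Pi.add_apply, h, mul_add]
  map_smul' c f := by
    rw [RingHom.id_apply, ← MemLp.toLp_const_smul]
    refine MemLp.toLp_congr _ _ ?_
    filter_upwards [Lp.coeFn_smul c f] with z h
    simp only [Pi.smul_apply, h, smul_eq_mul, mul_left_comm]

theorem mulOneSub_apply {μ : Measure ℂ} (hμ : ∀ᵐ z ∂μ, ‖z‖ ≤ 1) (f : Lp ℂ 2 μ) :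
    mulOneSub hμ f =ᵐ[μ] fun z => (1 - z) * f z :=
  (memLp_one_sub_mul hμ f).coeFn_toLp

theorem closure_mulImage_eq {μ : Measure ℂ} (hμ : ∀ᵐ z ∂μ, ‖z‖ ≤ 1) (h1 : ∀ᵐ z ∂μ, z ≠ 1)
    (N : Submodule ℂ (Lp ℂ 2 μ)) (hN : IsClosedShiftInvariant μ N) :
    closure (mulImage μ (fun z => 1 - z) (N : Set (Lp ℂ 2 μ))) = (N : Set (Lp ℂ 2 μ)) := by
  have himage : mulImage μ (fun z => 1 - z) (N : Set (Lp ℂ 2 μ)) =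
      mulOneSub hμ '' (N : Set (Lp ℂ 2 μ)) := by
    ext g
    constructor
    · rintro ⟨f, hf, hg⟩
      exact ⟨f, hf, Lp.ext ((mulOneSub_apply hμ f).trans hg.symm)⟩
    · rintro ⟨f, hf, rfl⟩
      exact ⟨f, hf, mulOneSub_apply hμ f⟩
  rw [himage]
  refine closure_image_eq_of_norm_sub_le _ N hN.closed ?_ ?_ ?_
  · intro f hf
    obtain ⟨g, hg, hgf⟩ := hN.shift f hf
    have : mulOneSub hμ f = f - g := by
      refine Lp.ext ?_
      filter_upwards [mulOneSub_apply hμ f, hgf, Lp.coeFn_sub f g] with z ha hb hc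
      rw [ha, hc, Pi.sub_apply, hb]
      ring
    rw [this]
    exact N.sub_mem hf hg
  · intro f _
    refine Lp.norm_le_norm_of_ae_le ?_
    filter_upwards [mulOneSub_apply hμ f, Lp.coeFn_sub f (mulOneSub hμ f), hμ] with z ha hb hz
    rw [hb, Pi.sub_apply, ha, show f z - (1 - z) * f z = z * f z by ring, norm_mul]
    exact mul_le_of_le_one_left (norm_nonneg _) hz
  · intro f _ hf
    refine Lp.ext ?_
    filter_upwards [mulOneSub_apply hμ f, Lp.coeFn_zero ℂ 2 μ, h1] with z ha hb hz
    rw [hf, hb, Pi.zero_apply, eq_comm, mul_eq_zero, sub_eq_zero] at ha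
    rw [hb, Pi.zero_apply]
    exact ha.resolve_left (Ne.symm hz)

/-! ### The explicit measure: support and the point `1` -/

/-- All the vertical lines `Re s = (n - 1) / 2` lie in `Re s ≥ -1/2`, with equality at `n = 0`. -/
theorem ae_krieteTruttMeasure_of_forall {P : ℂ → Prop} (hP : MeasurableSet {z | P z})
    (h : ∀ s : ℂ, -(1 / 2) ≤ s.re → P (s / (1 + s))) : ∀ᵐ z ∂krieteTruttMeasure, P z := by
  rw [krieteTruttMeasure, Measure.ae_sum_iff]
  intro n
  rw [ae_map_iff (by fun_prop) hP]
  refine Filter.Eventually.of_forall fun t => h _ ?_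
  have hn : (0 : ℝ) ≤ n := Nat.cast_nonneg n
  have : ((((n : ℂ) - 1) / 2 + t * Complex.I)).re = (n - 1) / 2 := by
    simp
  rw [this]
  linarith

theorem one_add_ne_zero_of_re {s : ℂ} (hs : -(1 / 2) ≤ s.re) : 1 + s ≠ 0 := by
  intro h
  have := congrArg Complex.re h
  simp at this
  linarith

theorem ae_norm_le_krieteTruttMeasure : ∀ᵐ z ∂krieteTruttMeasure, ‖z‖ ≤ 1 := by
  refine ae_krieteTruttMeasure_of_forall
    (measurableSet_le measurable_norm measurable_const) fun s hs => ?_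
  -- After squaring, the claim is `|1 + s|² - |s|² = 1 + 2 Re s ≥ 0`.
  rw [norm_div, div_le_one (norm_pos_iff.2 (one_add_ne_zero_of_re hs)),
    ← sq_le_sq₀ (norm_nonneg _) (norm_nonneg _), Complex.sq_norm, Complex.sq_norm,
    Complex.normSq_apply, Complex.normSq_apply]
  simp
  nlinarith

theorem ae_ne_one_krieteTruttMeasure : ∀ᵐ z ∂krieteTruttMeasure, z ≠ 1 := by
  refine ae_krieteTruttMeasure_of_forall (measurableSet_singleton (1 : ℂ)).compl fun s hs h => ?_
  rw [div_eq_one_iff_eq (one_add_ne_zero_of_re hs)] at h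
  simp at h

/-! ### The Cesàro operator on `ℓ²` -/

/-- The Hilbert space of square summable sequences. -/
abbrev Seq2 : Type := lp (fun _ : ℕ => ℂ) 2

theorem Seq2.hasSum_norm_sq (a : Seq2) : HasSum (fun n => ‖a n‖ ^ 2) (‖a‖ ^ 2) := by
  have := lp.hasSum_norm (p := 2) (by norm_num) a
  simpa using this

theorem memℓp_two_iff {a : ℕ → ℂ} :
    Memℓp (E := fun _ => ℂ) a 2 ↔ Summable fun n => ‖a n‖ ^ 2 := by
  rw [memℓp_gen_iff (by norm_num)]
  simp

/-- The Cesàro means of a sequence. -/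
def mean (a : ℕ → ℂ) (n : ℕ) : ℂ := (∑ k ∈ Finset.range (n + 1), a k) / ((n : ℂ) + 1)

theorem succ_mul_mean (a : ℕ → ℂ) (n : ℕ) :
    ((n : ℂ) + 1) * mean a n = ∑ k ∈ Finset.range (n + 1), a k :=
  mul_div_cancel₀ _ (Nat.cast_add_one_ne_zero n)

/-- At `n = 0` the truncated index `n - 1` is harmless, being multiplied by `n`. -/
theorem mean_recurrence (a : ℕ → ℂ) (n : ℕ) :
    ((n : ℂ) + 1) * mean a n = n * mean a (n - 1) + a n := by
  rw [succ_mul_mean, Finset.sum_range_succ]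
  cases n with
  | zero => simp
  | succ n =>
    rw [Nat.add_sub_cancel, Nat.cast_add_one, succ_mul_mean]

/-- With `A`, `B` the means at `n` and `n - 1`, substituting `a n = (n + 1) A - n B` shows that the
two sides differ by exactly `n |A - B|²`. The bracket telescopes when summed over `n`. -/
theorem norm_sq_sub_mean_le (a : ℕ → ℂ) (n : ℕ) :
    ‖a n - mean a n‖ ^ 2 + ((n + 1) * ‖mean a n‖ ^ 2 - n * ‖mean a (n - 1)‖ ^ 2) ≤
      ‖a n‖ ^ 2 := by
  have h := mean_recurrence a n
  set A := mean a n
  set B := mean a (n - 1)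
  have ha : a n = (n + 1) * A - n * B := by rw [h]; ring
  have hn : (0 : ℝ) ≤ n := Nat.cast_nonneg n
  rw [ha]
  simp only [Complex.sq_norm, Complex.normSq_apply]
  simp
  nlinarith [mul_nonneg hn (sq_nonneg (A.re - B.re)), mul_nonneg hn (sq_nonneg (A.im - B.im))]

theorem sum_norm_sq_sub_mean_le (a : ℕ → ℂ) (N : ℕ) :
    ∑ n ∈ Finset.range N, ‖a n - mean a n‖ ^ 2 + N * ‖mean a (N - 1)‖ ^ 2 ≤
      ∑ n ∈ Finset.range N, ‖a n‖ ^ 2 := by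
  induction N with
  | zero => simp
  | succ N ih =>
    have h := norm_sq_sub_mean_le a N
    rw [Finset.sum_range_succ, Finset.sum_range_succ, Nat.add_sub_cancel]
    push_cast
    linarith

theorem sum_norm_sq_sub_mean_le_norm_sq (a : Seq2) (N : ℕ) :
    ∑ n ∈ Finset.range N, ‖a n - mean a n‖ ^ 2 ≤ ‖a‖ ^ 2 := by
  refine le_trans ?_ ((sum_norm_sq_sub_mean_le a N).trans
    (sum_le_hasSum _ (fun n _ => by positivity) (Seq2.hasSum_norm_sq a)))
  linarith [mul_nonneg (Nat.cast_nonneg N) (sq_nonneg ‖mean a (N - 1)‖)]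

theorem memℓp_sub_mean (a : Seq2) :
    Memℓp (E := fun _ => ℂ) (fun n => a n - mean a n) 2 :=
  memℓp_two_iff.2 (summable_of_sum_range_le (fun _ => by positivity)
    (sum_norm_sq_sub_mean_le_norm_sq a))

/-- Writing the mean as `a - (a - mean a)` makes the contraction estimate do the work of Hardy's
inequality. -/
theorem memℓp_mean (a : Seq2) : Memℓp (E := fun _ => ℂ) (mean a) 2 := by
  have := (lp.memℓp a).sub (memℓp_sub_mean a)
  simpa [Pi.sub_def] using this

/-- The Cesàro operator on `ℓ²`. -/
def seqCesaro : Seq2 →ₗ[ℂ] Seq2 where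
  toFun a := ⟨mean a, memℓp_mean a⟩
  map_add' a b := by
    ext n
    change mean (fun k => a k + b k) n = mean a n + mean b n
    simp only [mean, Finset.sum_add_distrib, add_div]
  map_smul' c a := by
    ext n
    change mean (fun k => c * a k) n = c * mean a n
    simp only [mean, ← Finset.mul_sum, mul_div_assoc]

theorem seqCesaro_apply (a : Seq2) (n : ℕ) : seqCesaro a n = mean a n := rfl

theorem norm_sub_seqCesaro_le (a : Seq2) : ‖a - seqCesaro a‖ ≤ ‖a‖ := by
  rw [← sq_le_sq₀ (norm_nonneg _) (norm_nonneg _)]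
  rw [← (Seq2.hasSum_norm_sq (a - seqCesaro a)).tsum_eq]
  exact Real.tsum_le_of_sum_range_le (fun _ => by positivity)
    (sum_norm_sq_sub_mean_le_norm_sq a)

theorem seqCesaro_continuous : Continuous seqCesaro := by
  refine AddMonoidHomClass.continuous_of_bound seqCesaro 2 fun a => ?_
  calc ‖seqCesaro a‖ = ‖a - (a - seqCesaro a)‖ := by rw [sub_sub_cancel]
    _ ≤ ‖a‖ + ‖a - seqCesaro a‖ := norm_sub_le _ _
    _ ≤ 2 * ‖a‖ := by linarith [norm_sub_seqCesaro_le a]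

theorem eq_zero_of_seqCesaro_eq_zero {a : Seq2} (h : seqCesaro a = 0) : a = 0 := by
  ext n
  have hm : ∀ k, mean a k = 0 := fun k => by rw [← seqCesaro_apply, h]; rfl
  have := mean_recurrence a n
  rw [hm, hm, mul_zero, mul_zero, zero_add] at this
  exact this.symm

theorem closure_seqCesaro_image (M : Submodule ℂ Seq2) (hM : IsClosed (M : Set Seq2))
    (hinv : ∀ a ∈ M, seqCesaro a ∈ M) : closure (seqCesaro '' (M : Set Seq2)) = M :=
  closure_image_eq_of_norm_sub_le seqCesaro M hM hinv (fun a _ => norm_sub_seqCesaro_le a)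
    fun _ _ h => eq_zero_of_seqCesaro_eq_zero h

/-! ### Sequences with `(n + 1) β (n + 1) = (n - s) β n` -/

/-- The recurrence gives `(n + 1)² |β (n + 1)|² = |n - s|² |β n|²`. Since `Re s > -1/2`, for large
`n` the quantity `n |β n|²` drops by at least `ε |β n|²` at each step, so the squares are summable.
-/
theorem summable_norm_sq_of_recurrence {β : ℕ → ℂ} {s : ℂ} (hs : -(1 / 2) < s.re)
    (h : ∀ n : ℕ, ((n : ℂ) + 1) * β (n + 1) = (n - s) * β n) :
    Summable fun n => ‖β n‖ ^ 2 := by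
  set ε : ℝ := (2 * s.re + 1) / 2 with hε
  have hε0 : 0 < ε := by rw [hε]; linarith
  -- With `Re s = ε - 1/2`, the bound `|n - s|² ≤ (n + 1) (n - ε)` is equivalent to `|s|² + ε ≤ n
  -- ε`.
  obtain ⟨m, hm⟩ := exists_nat_ge ((‖s‖ ^ 2 + ε) / ε)
  have hstep : ∀ n : ℕ, m ≤ n →
      (n + 1) * ‖β (n + 1)‖ ^ 2 + ε * ‖β n‖ ^ 2 ≤ n * ‖β n‖ ^ 2 := by
    intro n hmn
    have hn1 : (0 : ℝ) < n + 1 := Nat.cast_add_one_pos n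
    have hmn' : (m : ℝ) ≤ n := Nat.cast_le.2 hmn
    have h2 : ((n : ℝ) + 1) ^ 2 * ‖β (n + 1)‖ ^ 2 = ‖(n : ℂ) - s‖ ^ 2 * ‖β n‖ ^ 2 := by
      have h3 := congrArg (fun z => ‖z‖ ^ 2) (h n)
      have h4 : ‖(n : ℂ) + 1‖ = (n : ℝ) + 1 := by exact_mod_cast Complex.norm_natCast (n + 1)
      simpa only [norm_mul, mul_pow, h4] using h3
    have h5 : ‖(n : ℂ) - s‖ ^ 2 = n ^ 2 - 2 * s.re * n + ‖s‖ ^ 2 := by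
      simp only [Complex.sq_norm, Complex.normSq_apply]
      simp
      ring
    have h6 : ‖s‖ ^ 2 + ε ≤ n * ε := by
      rw [div_le_iff₀ hε0] at hm
      nlinarith
    have h7 : (n : ℝ) ^ 2 - 2 * s.re * n + ‖s‖ ^ 2 ≤ (n + 1) * (n - ε) := by
      have : s.re = ε - 1 / 2 := by rw [hε]; ring
      rw [this]
      linarith
    have h8 : (n + 1 : ℝ) * ((n + 1) * ‖β (n + 1)‖ ^ 2) ≤ (n + 1) * ((n - ε) * ‖β n‖ ^ 2) := by
      rw [← mul_assoc, ← sq, h2, h5, ← mul_assoc]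
      exact mul_le_mul_of_nonneg_right h7 (sq_nonneg _)
    have h9 := le_of_mul_le_mul_left h8 hn1
    linarith
  rw [← summable_nat_add_iff m]
  refine summable_of_sum_range_le (c := m * ‖β m‖ ^ 2 / ε) (fun _ => by positivity) fun N => ?_
  have key : ε * ∑ n ∈ Finset.range N, ‖β (n + m)‖ ^ 2 + (N + m : ℕ) * ‖β (N + m)‖ ^ 2 ≤
      m * ‖β m‖ ^ 2 := by
    induction N with
    | zero => simp
    | succ N ih =>
      have h1 := hstep (N + m) (Nat.le_add_left m N)
      rw [Finset.sum_range_succ, mul_add, show N + 1 + m = N + m + 1 by ring]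
      push_cast at h1 ih ⊢
      linarith
  rw [le_div_iff₀ hε0, mul_comm]
  linarith [mul_nonneg (Nat.cast_nonneg (N + m)) (sq_nonneg ‖β (N + m)‖)]

theorem summable_mul_of_norm_sq {a b : ℕ → ℂ} (ha : Summable fun n => ‖a n‖ ^ 2)
    (hb : Summable fun n => ‖b n‖ ^ 2) : Summable fun n => a n * b n := by
  refine Summable.of_norm_bounded (ha.add hb) fun n => ?_
  rw [norm_mul]
  nlinarith [sq_nonneg (‖a n‖ - ‖b n‖), sq_nonneg (‖a n‖ + ‖b n‖)]

/-- A convergent sequence whose quotients by `n - s` are summable tends to zero. -/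
theorem eq_zero_of_tendsto_of_summable {D u : ℕ → ℂ} {s L : ℂ}
    (hD : Filter.Tendsto D Filter.atTop (nhds L)) (hu : Summable u)
    (h : ∀ n : ℕ, D n = (n - s) * u n) : L = 0 := by
  by_contra hL
  have hL' : 0 < ‖L‖ := norm_pos_iff.2 hL
  have h1 : ∀ᶠ n : ℕ in Filter.atTop, ‖L‖ / 2 < ‖D n‖ :=
    hD.norm.eventually (lt_mem_nhds (by linarith))
  -- A nonzero limit would force `|u n|` to be at least a constant times `1 / n`.
  have hharm : ¬ Summable fun n : ℕ => 1 / (n : ℝ) := Real.not_summable_one_div_natCast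
  refine hharm ?_
  have h2 : Summable fun n : ℕ => (2 * (1 + ‖s‖) / ‖L‖) * ‖u n‖ := hu.norm.mul_left _
  refine Summable.of_norm_bounded_eventually_nat h2 ?_
  filter_upwards [h1, Filter.eventually_ge_atTop 1] with n hn hn1
  have hn1' : (1 : ℝ) ≤ n := by exact_mod_cast hn1
  have h3 : ‖D n‖ ≤ (n * (1 + ‖s‖)) * ‖u n‖ := by
    rw [h n, norm_mul]
    gcongr
    calc ‖(n : ℂ) - s‖ ≤ ‖(n : ℂ)‖ + ‖s‖ := norm_sub_le _ _
      _ ≤ n * (1 + ‖s‖) := by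
        rw [Complex.norm_natCast]
        nlinarith [norm_nonneg s]
  rw [Real.norm_of_nonneg (by positivity), div_mul_eq_mul_div,
    div_le_div_iff₀ (by linarith) hL']
  nlinarith

/-- Summation by parts: the termwise difference of the two sides telescopes through `D n = n * mean
a (n - 1) * β n`, so only the limit of `D` has to vanish. -/
theorem one_add_mul_tsum_mean_mul {β : ℕ → ℂ} {s : ℂ} (hs : -(1 / 2) < s.re)
    (h : ∀ n : ℕ, ((n : ℂ) + 1) * β (n + 1) = (n - s) * β n) (a : Seq2) :
    (1 + s) * ∑' n, seqCesaro a n * β n = ∑' n, a n * β n := by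
  have hβ := summable_norm_sq_of_recurrence hs h
  have h1 := summable_mul_of_norm_sq (Seq2.hasSum_norm_sq a).summable hβ
  have h2 := summable_mul_of_norm_sq (Seq2.hasSum_norm_sq (seqCesaro a)).summable hβ
  set D : ℕ → ℂ := fun n => n * mean a (n - 1) * β n
  have hD : ∀ n, a n * β n - (1 + s) * (seqCesaro a n * β n) = D (n + 1) - D n := by
    intro n
    have h3 := mean_recurrence a n
    have h4 := h n
    simp only [D, seqCesaro_apply, Nat.add_sub_cancel]
    push_cast
    linear_combination (-β n) * h3 - mean a n * h4
  have h5 : HasSum (fun n => D (n + 1) - D n)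
      (∑' n, a n * β n - (1 + s) * ∑' n, seqCesaro a n * β n) := by
    simpa only [hD] using h1.hasSum.sub (h2.hasSum.mul_left (1 + s))
  have h6 := h5.tendsto_sum_nat
  simp only [Finset.sum_range_sub] at h6
  have hD0 : D 0 = 0 := by simp [D]
  simp only [hD0, sub_zero] at h6
  -- The recurrence for `β` gives `D (n + 1) = (n - s) * (mean a n * β n)`, a factor `n - s` times a
  -- summable term.
  have h7 := eq_zero_of_tendsto_of_summable (s := s)
    ((Filter.tendsto_add_atTop_iff_nat 1).2 h6) h2 fun n => by
      have h4 := h n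
      simp only [D, seqCesaro_apply, Nat.add_sub_cancel]
      push_cast
      linear_combination mean a n * h4
  exact (sub_eq_zero.1 h7).symm

/-! ### Power series on the disk -/

theorem mem_disk_of_nonneg {r : ℝ} (h0 : 0 ≤ r) (h1 : r < 1) : (r : ℂ) ∈ disk := by
  rwa [mem_ball_zero_iff, Complex.norm_real, Real.norm_of_nonneg h0]

theorem hasFPowerSeriesOnBall_of_hasSum {f : ℂ → ℂ} {b : ℕ → ℂ}
    (h : ∀ z ∈ disk, HasSum (fun n => b n * z ^ n) (f z)) :
    HasFPowerSeriesOnBall f (FormalMultilinearSeries.ofScalars ℂ b) 0 1 where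
  r_le := by
    refine ENNReal.le_of_forall_nnreal_lt fun r hr => ?_
    refine FormalMultilinearSeries.le_radius_of_summable _ ?_
    have hr' : (r : ℝ) < 1 := by exact_mod_cast hr
    have h1 := (h _ (mem_disk_of_nonneg r.2 hr')).summable.norm
    simpa [FormalMultilinearSeries.ofScalars_norm] using h1
  r_pos := one_pos
  hasSum := by
    intro y hy
    rw [zero_add]
    have hy' : y ∈ disk := by
      rw [← ENNReal.ofReal_one, Metric.eball_ofReal] at hy
      exact hy
    simpa [FormalMultilinearSeries.ofScalars_apply_eq, mul_comm] using h y hy'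

theorem taylorCoeff_eq_of_hasSum {f : ℂ → ℂ} {b : ℕ → ℂ}
    (h : ∀ z ∈ disk, HasSum (fun n => b n * z ^ n) (f z)) : taylorCoeff f = b := by
  funext n
  have h1 := (hasFPowerSeriesOnBall_of_hasSum h).factorial_smul 1 n
  rw [taylorCoeff, iteratedDeriv_eq_iteratedFDeriv,
    div_eq_iff (by exact_mod_cast n.factorial_ne_zero), ← h1, FormalMultilinearSeries.ofScalars_apply_eq]
  simp [mul_comm]

theorem differentiableOn_of_hasSum {f : ℂ → ℂ} {b : ℕ → ℂ}
    (h : ∀ z ∈ disk, HasSum (fun n => b n * z ^ n) (f z)) : DifferentiableOn ℂ f disk := by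
  have h1 := (hasFPowerSeriesOnBall_of_hasSum h).differentiableOn
  rwa [← ENNReal.ofReal_one, Metric.eball_ofReal] at h1

theorem hasSum_taylorCoeff {f : ℂ → ℂ} (hf : DifferentiableOn ℂ f disk) {z : ℂ}
    (hz : z ∈ disk) : HasSum (fun n => taylorCoeff f n * z ^ n) (f z) := by
  have h := Complex.hasSum_taylorSeries_on_ball hf hz
  simp only [sub_zero, smul_eq_mul] at h
  refine h.congr_fun fun n => ?_
  rw [taylorCoeff]
  ring

/-! ### Parseval's identity -/

theorem _root_.Orthonormal.hasSum_norm_sq {E : Type*} [NormedAddCommGroup E]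
    [InnerProductSpace ℂ E] {v : ℕ → E} (hv : Orthonormal ℂ v) {c : ℕ → ℂ} {F : E}
    (h : HasSum (fun n => c n • v n) F) : HasSum (fun n => ‖c n‖ ^ 2) (‖F‖ ^ 2) := by
  have h1 : ∀ k, inner ℂ (v k) F = c k := by
    intro k
    have h2 : HasSum (fun n => inner ℂ (v k) (c n • v n)) (inner ℂ (v k) F) :=
      h.mapL (innerSL ℂ (v k))
    refine h2.unique ?_
    have h3 := hasSum_single (f := fun n => inner ℂ (v k) (c n • v n)) k fun n hn => by
      rw [inner_smul_right, hv.2 hn.symm, mul_zero]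
    simpa [inner_smul_right, inner_self_eq_norm_sq_to_K, hv.1 k] using h3
  have h4 : HasSum (fun n => inner ℂ F (c n • v n)) (inner ℂ F F) := h.mapL (innerSL ℂ F)
  have h5 := Complex.hasSum_re h4
  rw [← inner_self_eq_norm_sq (𝕜 := ℂ) F]
  refine h5.congr_fun fun n => ?_
  rw [inner_smul_right, ← inner_conj_symm, h1, Complex.mul_conj, Complex.ofReal_re,
    Complex.normSq_eq_norm_sq]

/-- On the circle of radius `r < 1` the power series converges uniformly, hence in `L²`, where it is
a Fourier series with coefficients `b n * r ^ n`. -/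
theorem hasSum_circleMean {f : ℂ → ℂ} {b : ℕ → ℂ}
    (h : ∀ z ∈ disk, HasSum (fun n => b n * z ^ n) (f z)) {r : ℝ} (hr : r ∈ Set.Ioo (0 : ℝ) 1) :
    circleMean f r ≠ ⊤ ∧ HasSum (fun n => (‖b n‖ * r ^ n) ^ 2) ((circleMean f r).toReal ^ 2) := by
  set c : ℕ → ℂ := fun n => b n * (r : ℂ) ^ n with hc
  have hcn : ∀ n, ‖c n‖ = ‖b n‖ * r ^ n := fun n => by
    rw [hc, norm_mul, norm_pow, Complex.norm_real, Real.norm_of_nonneg hr.1.le]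
  have hsum : Summable fun n => c n • (fourier (n : ℤ) : C(UnitAddCircle, ℂ)) := by
    refine Summable.of_norm ?_
    simpa only [norm_smul, fourier_norm, mul_one] using
      (h _ (mem_disk_of_nonneg hr.1.le hr.2)).summable.norm
  obtain ⟨g, hg⟩ := hsum
  have hgf : ∀ θ : UnitAddCircle, g θ = f ((r : ℂ) * (AddCircle.toCircle θ : ℂ)) := by
    intro θ
    have h1 := hg.mapL (ContinuousMap.evalCLM ℂ θ)
    refine h1.unique ((h _ (circle_mem_disk hr θ)).congr_fun fun n => ?_)
    simp [hc, fourier_apply, AddCircle.toCircle_nsmul, mul_pow, mul_assoc]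
  have hL := hg.mapL (ContinuousMap.toLp (E := ℂ) 2 AddCircle.haarAddCircle ℂ)
  simp only [map_smul] at hL
  have hv : Orthonormal ℂ fun n : ℕ => fourierLp (T := 1) 2 (n : ℤ) :=
    orthonormal_fourier.comp _ Nat.cast_injective
  have hP := hv.hasSum_norm_sq hL
  have hnorm : circleMean f r =
      ‖ContinuousMap.toLp (E := ℂ) 2 AddCircle.haarAddCircle ℂ g‖ₑ := by
    rw [Lp.enorm_def, circleMean]
    refine eLpNorm_congr_ae ?_
    filter_upwards [ContinuousMap.coeFn_toLp (p := 2) (𝕜 := ℂ) AddCircle.haarAddCircle g]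
      with θ hθ
    rw [hθ, hgf]
  rw [hnorm]
  refine ⟨enorm_ne_top, ?_⟩
  rw [toReal_enorm]
  simpa only [hcn] using hP

theorem hardyENorm_sq {f : ℂ → ℂ} {b : ℕ → ℂ}
    (h : ∀ z ∈ disk, HasSum (fun n => b n * z ^ n) (f z)) :
    hardyENorm f ^ 2 = ∑' n, ENNReal.ofReal (‖b n‖ ^ 2) := by
  have hmean : ∀ r ∈ Set.Ioo (0 : ℝ) 1,
      circleMean f r ^ 2 = ∑' n, ENNReal.ofReal ((‖b n‖ * r ^ n) ^ 2) := by
    intro r hr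
    obtain ⟨h1, h2⟩ := hasSum_circleMean h hr
    rw [← ENNReal.ofReal_tsum_of_nonneg (fun n => sq_nonneg _) h2.summable, h2.tsum_eq,
      ENNReal.ofReal_pow ENNReal.toReal_nonneg, ENNReal.ofReal_toReal h1]
  refine le_antisymm ?_ ?_
  · rw [← ENNReal.rpow_natCast, ← ENNReal.le_rpow_inv_iff (by norm_num)]
    refine iSup₂_le fun r hr => ?_
    rw [ENNReal.le_rpow_inv_iff (by norm_num), ENNReal.rpow_natCast, hmean r hr]
    refine ENNReal.tsum_le_tsum fun n => ENNReal.ofReal_le_ofReal ?_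
    have : ‖b n‖ * r ^ n ≤ ‖b n‖ :=
      mul_le_of_le_one_right (norm_nonneg _) (pow_le_one₀ hr.1.le hr.2.le)
    have h0 : 0 ≤ ‖b n‖ * r ^ n := mul_nonneg (norm_nonneg _) (pow_nonneg hr.1.le n)
    gcongr
  -- Each partial sum is a limit as `r → 1⁻` of partial sums bounded by `circleMean f r ^ 2`.
  · refine ENNReal.tsum_le_of_sum_range_le fun N => ?_
    have hcont : Continuous fun r : ℝ =>
        ∑ n ∈ Finset.range N, ENNReal.ofReal ((‖b n‖ * r ^ n) ^ 2) := by
      refine continuous_finsetSum _ fun n _ => ENNReal.continuous_ofReal.comp ?_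
      fun_prop
    have hlim := (hcont.tendsto 1).mono_left (nhdsWithin_le_nhds (s := Set.Iio 1))
    simp only [one_pow, mul_one] at hlim
    refine le_of_tendsto hlim ?_
    filter_upwards [Ioo_mem_nhdsLT (zero_lt_one' ℝ)] with r hr
    calc ∑ n ∈ Finset.range N, ENNReal.ofReal ((‖b n‖ * r ^ n) ^ 2) ≤ circleMean f r ^ 2 := by
          rw [hmean r hr]
          exact ENNReal.sum_le_tsum _
      _ ≤ hardyENorm f ^ 2 := by
          gcongr
          exact le_iSup₂ (f := fun r _ => circleMean f r) r hr

/-! ### Identification of `H²` with `ℓ²` -/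

theorem H2.hasSum (f : H2) {z : ℂ} (hz : z ∈ disk) :
    HasSum (fun n => taylorCoeff f n * z ^ n) (f z) :=
  hasSum_taylorCoeff f.2.1 hz

theorem H2.ext_disk {f g : H2} (h : ∀ z ∈ disk, f z = g z) : f = g := by
  refine Subtype.ext (funext fun z => ?_)
  by_cases hz : z ∈ disk
  · exact h z hz
  · exact (f.2.2.1 z hz).trans (g.2.2.1 z hz).symm

theorem H2.hasSum_norm_sq (f : H2) : HasSum (fun n => ‖taylorCoeff f n‖ ^ 2) (‖f‖ ^ 2) := by
  have h := hardyENorm_sq fun z hz => f.hasSum hz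
  have hfin : hardyENorm f ≠ ⊤ := f.2.2.2.ne
  have h1 : ∑' n, ENNReal.ofReal (‖taylorCoeff f n‖ ^ 2) ≠ ⊤ := h ▸ ENNReal.pow_ne_top hfin
  have h2 := (ENNReal.hasSum_toReal h1)
  rw [← ENNReal.tsum_toReal_eq (fun _ => ENNReal.ofReal_ne_top), ← h, ENNReal.toReal_pow,
    ← H2.norm_def] at h2
  simpa only [ENNReal.toReal_ofReal (sq_nonneg _)] using h2

theorem hasSum_seq (a : Seq2) {z : ℂ} (hz : z ∈ disk) :
    HasSum (fun n => a n * z ^ n) (disk.indicator (fun z => ∑' n, a n * z ^ n) z) := by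
  rw [Set.indicator_of_mem hz]
  refine (summable_mul_of_norm_sq (Seq2.hasSum_norm_sq a).summable ?_).hasSum
  have hz1 : ‖z‖ < 1 := by simpa using hz
  have : ∀ n : ℕ, ‖z ^ n‖ ^ 2 = (‖z‖ ^ 2) ^ n := fun n => by
    rw [norm_pow, ← pow_mul, ← pow_mul, mul_comm]
  simp only [this]
  exact summable_geometric_of_lt_one (sq_nonneg _) (pow_lt_one₀ (norm_nonneg _) hz1 two_ne_zero)

/-- The function in `H²` with given Taylor coefficients. -/
def ofSeq (a : Seq2) : H2 :=
  ⟨disk.indicator fun z => ∑' n, a n * z ^ n,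
    differentiableOn_of_hasSum fun _ hz => hasSum_seq a hz,
    fun _ hz => Set.indicator_of_notMem hz _, by
      have h := hardyENorm_sq fun z hz => hasSum_seq a hz
      have hs := (Seq2.hasSum_norm_sq a).summable
      rw [← ENNReal.ofReal_tsum_of_nonneg (fun n => sq_nonneg _) hs] at h
      refine lt_top_iff_ne_top.2 fun htop => ?_
      rw [htop] at h
      exact ENNReal.ofReal_ne_top (h.symm.trans (by simp))⟩

theorem taylorCoeff_ofSeq (a : Seq2) : taylorCoeff (ofSeq a) = a :=
  taylorCoeff_eq_of_hasSum fun _ hz => hasSum_seq a hz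

/-- `H²` is isometric to `ℓ²` through the Taylor coefficients. -/
def coeffEquiv : H2 ≃ₗᵢ[ℂ] Seq2 where
  toFun f := ⟨taylorCoeff f, memℓp_two_iff.2 f.hasSum_norm_sq.summable⟩
  invFun := ofSeq
  left_inv f := by
    refine H2.ext_disk fun z hz => ((ofSeq _).hasSum hz).unique ?_
    rw [taylorCoeff_ofSeq]
    exact f.hasSum hz
  right_inv a := lp.ext (taylorCoeff_ofSeq a)
  map_add' f g := by
    refine lp.ext (taylorCoeff_eq_of_hasSum fun z hz => ?_)
    refine ((f.hasSum hz).add (g.hasSum hz)).congr_fun fun n => ?_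
    exact (add_mul _ _ _)
  map_smul' c f := by
    refine lp.ext (taylorCoeff_eq_of_hasSum fun z hz => ?_)
    refine ((f.hasSum hz).mul_left c).congr_fun fun n => ?_
    exact mul_assoc _ _ _
  norm_map' f := by
    have h := (Seq2.hasSum_norm_sq ⟨taylorCoeff f, memℓp_two_iff.2 f.hasSum_norm_sq.summable⟩).unique
      f.hasSum_norm_sq
    exact (sq_eq_sq₀ (norm_nonneg _) (norm_nonneg _)).1 h

theorem coe_coeffEquiv (f : H2) : ⇑(coeffEquiv f) = taylorCoeff f := rfl

/-! ### The Cesàro operator on Taylor coefficients -/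

/-- Cauchy product with the geometric series. -/
theorem hasSum_div_one_sub {f : ℂ → ℂ} {b : ℕ → ℂ}
    (h : ∀ z ∈ disk, HasSum (fun n => b n * z ^ n) (f z)) {z : ℂ} (hz : z ∈ disk) :
    HasSum (fun n => (∑ k ∈ Finset.range (n + 1), b k) * z ^ n) (f z / (1 - z)) := by
  have hz1 : ‖z‖ < 1 := by simpa using hz
  have h1 := (h z hz).summable.norm
  have h2 := summable_norm_geometric_of_norm_lt_one hz1
  have h3 := (summable_norm_sum_mul_antidiagonal_of_summable_norm h1 h2).of_norm.hasSum
  rw [← tsum_mul_tsum_eq_tsum_sum_antidiagonal_of_summable_norm h1 h2, (h z hz).tsum_eq,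
    tsum_geometric_of_norm_lt_one hz1, ← div_eq_mul_inv] at h3
  refine h3.congr_fun fun n => ?_
  rw [Finset.Nat.sum_antidiagonal_eq_sum_range_succ (fun i j => b i * z ^ i * z ^ j),
    Finset.sum_mul]
  refine Finset.sum_congr rfl fun k hk => ?_
  rw [mul_assoc, ← pow_add, Nat.add_sub_cancel' (Finset.mem_range_succ_iff.1 hk)]

/-- The series of `f / (1 - ·)` is integrated term by term along the segment; `∫₀¹ tⁿ dt = 1 / (n +
1)` turns partial sums into means. -/
theorem hasSum_cesaro {f : ℂ → ℂ} {b : ℕ → ℂ}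
    (h : ∀ z ∈ disk, HasSum (fun n => b n * z ^ n) (f z)) {z : ℂ} (hz : z ∈ disk) :
    HasSum (fun n => mean b n * z ^ n) (cesaro f z) := by
  rw [cesaro]
  split_ifs with hz0
  · subst hz0
    have h0 : f 0 = mean b 0 * 0 ^ 0 := by
      refine (h 0 hz).unique ?_
      have := hasSum_single (f := fun n => b n * (0 : ℂ) ^ n) 0 fun n hn => by simp [hn]
      simpa [mean] using this
    rw [h0]
    exact hasSum_single (f := fun n => mean b n * (0 : ℂ) ^ n) 0 fun n hn => by simp [hn]
  · rw [intervalIntegral.integral_const_mul, inv_mul_cancel_left₀ hz0]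
    have hz1 : ‖z‖ < 1 := by simpa using hz
    have ht : ∀ t ∈ Set.uIoc (0 : ℝ) 1, (t : ℂ) * z ∈ disk := by
      intro t ht
      rw [Set.uIoc_of_le zero_le_one] at ht
      rw [mem_ball_zero_iff, norm_mul, Complex.norm_real, Real.norm_of_nonneg ht.1.le]
      exact (mul_le_of_le_one_left (norm_nonneg z) ht.2).trans_lt hz1
    have key := intervalIntegral.hasSum_integral_of_dominated_convergence
      (μ := volume) (a := 0) (b := 1)
      (F := fun n (t : ℝ) => (∑ k ∈ Finset.range (n + 1), b k) * (t * z) ^ n)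
      (f := fun t : ℝ => f (t * z) / (1 - t * z))
      (fun n _ => ‖(∑ k ∈ Finset.range (n + 1), b k) * z ^ n‖)
      (fun n => (by fun_prop : Continuous fun t : ℝ =>
        (∑ k ∈ Finset.range (n + 1), b k) * ((t : ℂ) * z) ^ n).aestronglyMeasurable)
      (fun n => Filter.Eventually.of_forall fun t ht => by
        rw [Set.uIoc_of_le zero_le_one] at ht
        rw [norm_mul, norm_mul, norm_pow, norm_pow, norm_mul, Complex.norm_real,
          Real.norm_of_nonneg ht.1.le]
        have := ht.1.le
        gcongr
        exact mul_le_of_le_one_left (norm_nonneg z) ht.2)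
      (Filter.Eventually.of_forall fun _ _ => (hasSum_div_one_sub h hz).summable.norm)
      intervalIntegrable_const
      (Filter.Eventually.of_forall fun t hmem => hasSum_div_one_sub h (ht t hmem))
    refine key.congr_fun fun n => ?_
    simp only [mul_pow]
    have hint : ∫ t in (0 : ℝ)..1, (t : ℂ) ^ n = 1 / ((n : ℂ) + 1) := by
      have := integral_pow (a := 0) (b := 1) n
      have h2 : ∫ t in (0 : ℝ)..1, (t : ℂ) ^ n = ((∫ t in (0 : ℝ)..1, t ^ n : ℝ) : ℂ) := by
        rw [← intervalIntegral.integral_ofReal]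
        simp
      rw [h2, this]
      simp
    rw [intervalIntegral.integral_const_mul, intervalIntegral.integral_mul_const, hint, mean]
    ring

theorem eq_cesaro_iff (f g : H2) :
    (∀ z ∈ disk, g z = cesaro f z) ↔ coeffEquiv g = seqCesaro (coeffEquiv f) := by
  constructor
  · intro h
    refine lp.ext (taylorCoeff_eq_of_hasSum fun z hz => ?_)
    rw [h z hz]
    exact hasSum_cesaro (fun z hz => f.hasSum hz) hz
  · intro h z hz
    refine (g.hasSum hz).unique ?_
    rw [← coe_coeffEquiv, h]
    exact hasSum_cesaro (fun z hz => f.hasSum hz) hz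

theorem closure_cesaroImage_eq (M : Submodule ℂ H2) (hM : IsClosed (M : Set H2))
    (hinv : ∀ f ∈ M, ∃ g ∈ M, ∀ z ∈ disk, g z = cesaro f z) :
    closure (cesaroImage (M : Set H2)) = (M : Set H2) := by
  set M' : Submodule ℂ Seq2 := M.map (coeffEquiv.toLinearEquiv : H2 →ₗ[ℂ] Seq2)
  have hcoe : (M' : Set Seq2) = coeffEquiv '' (M : Set H2) := rfl
  have himage : coeffEquiv '' cesaroImage (M : Set H2) = seqCesaro '' (M' : Set Seq2) := by
    rw [hcoe]
    ext a
    constructor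
    · rintro ⟨g, ⟨f, hf, hgf⟩, rfl⟩
      exact ⟨_, ⟨f, hf, rfl⟩, ((eq_cesaro_iff f g).1 hgf).symm⟩
    · rintro ⟨_, ⟨f, hf, rfl⟩, rfl⟩
      exact ⟨coeffEquiv.symm (seqCesaro (coeffEquiv f)),
        ⟨f, hf, (eq_cesaro_iff _ _).2 (coeffEquiv.apply_symm_apply _)⟩,
        coeffEquiv.apply_symm_apply _⟩
  have key := closure_seqCesaro_image M'
    (by rw [hcoe]; exact coeffEquiv.toHomeomorph.isClosedMap _ hM) (by
      rintro _ ⟨f, hf, rfl⟩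
      obtain ⟨g, hg, hgf⟩ := hinv f hf
      exact ⟨g, hg, (eq_cesaro_iff f g).1 hgf⟩)
  rw [← himage, hcoe] at key
  refine coeffEquiv.injective.image_injective ?_
  rw [← key]
  exact coeffEquiv.toHomeomorph.image_closure _

/-! ### The Kriete–Trutt transform -/

theorem succ_mul_choose_succ (s : ℂ) (n : ℕ) :
    ((n : ℂ) + 1) * Ring.choose s (n + 1) = (s - n) * Ring.choose s n := by
  have h1 := Ring.descPochhammer_eq_factorial_smul_choose s n
  have h2 := Ring.descPochhammer_eq_factorial_smul_choose s (n + 1)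
  rw [descPochhammer_succ_right, Polynomial.smeval_mul, h1] at h2
  have h3 : (n.factorial : ℂ) ≠ 0 := Nat.cast_ne_zero.2 n.factorial_ne_zero
  simp [Polynomial.smeval_sub, Polynomial.smeval_natCast, Nat.factorial_succ] at h2
  refine mul_left_cancel₀ h3 ?_
  linear_combination -h2

theorem taylorCoeff_q (w : ℂ) :
    taylorCoeff (q w) = fun n => (-1) ^ n * Ring.choose (w / (1 - w)) n := by
  refine taylorCoeff_eq_of_hasSum fun z hz => ?_
  have hz' : -z ∈ Metric.eball (0 : ℂ) 1 := by
    rw [← ENNReal.ofReal_one, Metric.eball_ofReal]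
    simpa using hz
  have h := (Complex.one_add_cpow_hasFPowerSeriesOnBall_zero (a := w / (1 - w))).hasSum hz'
  rw [zero_add, ← sub_eq_add_neg] at h
  refine h.congr_fun fun n => ?_
  rw [binomialSeries_apply, List.ofFn_const, List.prod_replicate, neg_pow z, smul_eq_mul]
  ring

theorem taylorCoeff_q_zero (w : ℂ) : taylorCoeff (q w) 0 = 1 := by
  simp [taylorCoeff_q]

/-- The two conjugations cancel, so the sequence satisfies the recurrence of the previous section
with `s = w / (1 - w)`. -/
theorem conj_taylorCoeff_q_recurrence (w : ℂ) (n : ℕ) :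
    ((n : ℂ) + 1) * (starRingEnd ℂ) (taylorCoeff (q ((starRingEnd ℂ) w)) (n + 1)) =
      (n - w / (1 - w)) * (starRingEnd ℂ) (taylorCoeff (q ((starRingEnd ℂ) w)) n) := by
  have h := succ_mul_choose_succ ((starRingEnd ℂ) w / (1 - (starRingEnd ℂ) w)) n
  have h1 := congrArg (starRingEnd ℂ) h
  simp only [map_mul, map_add, map_sub, map_div₀, map_one, Complex.conj_conj, map_natCast] at h1
  simp only [taylorCoeff_q, map_mul, map_pow, map_neg, map_one, pow_succ]
  linear_combination (-(-1) ^ n) * h1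

theorem one_sub_ne_zero_of_mem_disk {w : ℂ} (hw : w ∈ disk) : 1 - w ≠ 0 := by
  intro h
  rw [← sub_eq_zero.1 h] at hw
  simp at hw

/-- Here `(2 Re (w / (1 - w)) + 1) |1 - w|² = 1 - |w|²`, which is positive. -/
theorem neg_half_lt_re_of_mem_disk {w : ℂ} (hw : w ∈ disk) :
    -(1 / 2) < (w / (1 - w)).re := by
  have h0 : 0 < Complex.normSq (1 - w) := Complex.normSq_pos.2 (one_sub_ne_zero_of_mem_disk hw)
  have hw1 : ‖w‖ ^ 2 < 1 := pow_lt_one₀ (norm_nonneg _) (by simpa using hw) two_ne_zero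
  rw [Complex.sq_norm, Complex.normSq_apply] at hw1
  rw [Complex.div_re, ← add_div, lt_div_iff₀ h0, Complex.normSq_apply]
  simp
  nlinarith

/-- The Kriete–Trutt transform in terms of Taylor coefficients. -/
def seqTransform (a : ℕ → ℂ) (w : ℂ) : ℂ :=
  ∑' n, a n * (starRingEnd ℂ) (taylorCoeff (q ((starRingEnd ℂ) w)) n)

theorem summable_seqTransform (a : Seq2) {w : ℂ} (hw : w ∈ disk) :
    Summable fun n => a n * (starRingEnd ℂ) (taylorCoeff (q ((starRingEnd ℂ) w)) n) :=
  summable_mul_of_norm_sq (Seq2.hasSum_norm_sq a).summable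
    (summable_norm_sq_of_recurrence (neg_half_lt_re_of_mem_disk hw)
      (conj_taylorCoeff_q_recurrence w))

theorem ktTransform_eq (f : H2) (w : ℂ) : ktTransform f w = seqTransform (coeffEquiv f) w := rfl

/-- For `s = w / (1 - w)` the factor `1 + s` is `1 / (1 - w)`. -/
theorem seqTransform_seqCesaro (a : Seq2) {w : ℂ} (hw : w ∈ disk) :
    seqTransform (seqCesaro a) w = (1 - w) * seqTransform a w := by
  have h := one_add_mul_tsum_mean_mul
    (β := fun n => (starRingEnd ℂ) (taylorCoeff (q ((starRingEnd ℂ) w)) n))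
    (neg_half_lt_re_of_mem_disk hw)
    (conj_taylorCoeff_q_recurrence w) a
  have hw0 := one_sub_ne_zero_of_mem_disk hw
  have h1 : 1 + w / (1 - w) = (1 - w)⁻¹ := by
    field_simp
    ring
  rw [h1, inv_mul_eq_iff_eq_mul₀ hw0] at h
  exact h

/-- The sequences whose transform is a polynomial. -/
def polySeq : Submodule ℂ Seq2 where
  carrier := {a | ∃ p : Polynomial ℂ, ∀ w ∈ disk, seqTransform a w = p.eval w}
  zero_mem' := ⟨0, fun w _ => by simp [seqTransform]⟩
  add_mem' := by
    rintro a b ⟨p, hp⟩ ⟨r, hr⟩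
    refine ⟨p + r, fun w hw => ?_⟩
    rw [Polynomial.eval_add, ← hp w hw, ← hr w hw, seqTransform, seqTransform, seqTransform,
      ← (summable_seqTransform a hw).tsum_add (summable_seqTransform b hw)]
    exact tsum_congr fun n => add_mul _ _ _
  smul_mem' := by
    rintro c a ⟨p, hp⟩
    refine ⟨c • p, fun w hw => ?_⟩
    rw [Polynomial.eval_smul, ← hp w hw, smul_eq_mul, seqTransform, seqTransform, ← tsum_mul_left]
    exact tsum_congr fun n => mul_assoc _ _ _

theorem seqTransform_sub (a b : Seq2) {w : ℂ} (hw : w ∈ disk) :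
    seqTransform (a - b : Seq2) w = seqTransform a w - seqTransform b w := by
  rw [seqTransform, seqTransform, seqTransform,
    ← (summable_seqTransform a hw).tsum_sub (summable_seqTransform b hw)]
  exact tsum_congr fun n => sub_mul _ _ _

theorem seqTransform_single (w : ℂ) :
    seqTransform (lp.single 2 0 (1 : ℂ) : Seq2) w = 1 := by
  rw [seqTransform, tsum_eq_single 0]
  · simp [taylorCoeff_q_zero]
  · intro n hn
    simp [hn]

/-- Polynomials with value `1` at `1` have arbitrarily small norm in the Kriete–Trutt space. -/
theorem exists_polynomial_norm_lt {ε : ℝ} (hε : 0 < ε) :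
    ∃ (p : Polynomial ℂ) (f : H2), (∀ w ∈ disk, ktTransform f w = p.eval w) ∧
      p.eval 1 = 1 ∧ ‖f‖ < ε := by
  set e : Seq2 := lp.single 2 0 (1 : ℂ)
  have he : e ∈ polySeq := ⟨1, fun w _ => by rw [seqTransform_single, Polynomial.eval_one]⟩
  have hstep : ∀ a ∈ polySeq, seqCesaro a ∈ polySeq := by
    rintro a ⟨p, hp⟩
    exact ⟨(1 - Polynomial.X) * p, fun w hw => by
      rw [seqTransform_seqCesaro a hw, hp w hw]
      simp⟩
  have hinv : ∀ a ∈ polySeq.topologicalClosure, seqCesaro a ∈ polySeq.topologicalClosure :=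
    fun a ha => map_mem_closure seqCesaro_continuous ha hstep
  have hcl := closure_seqCesaro_image _ polySeq.isClosed_topologicalClosure hinv
  -- Density is known for the image of the closure of `polySeq`; continuity of `seqCesaro` brings it
  -- back to the image of `polySeq` itself, so that the approximant has a polynomial transform.
  have hmem : e ∈ closure (seqCesaro '' (polySeq : Set Seq2)) := by
    have h1 : e ∈ closure (seqCesaro '' closure (polySeq : Set Seq2)) := by
      rw [← Submodule.topologicalClosure_coe, hcl]
      exact polySeq.le_topologicalClosure he
    exact closure_minimal (image_closure_subset_closure_image seqCesaro_continuous)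
      isClosed_closure h1
  obtain ⟨_, ⟨a, ⟨p, hp⟩, rfl⟩, hd⟩ := Metric.mem_closure_iff.1 hmem ε hε
  refine ⟨1 - (1 - Polynomial.X) * p, coeffEquiv.symm (e - seqCesaro a), fun w hw => ?_, ?_, ?_⟩
  · rw [ktTransform_eq, LinearIsometryEquiv.apply_symm_apply, seqTransform_sub _ _ hw,
      seqTransform_single, seqTransform_seqCesaro a hw, hp w hw]
    simp
  · simp
  · rwa [LinearIsometryEquiv.norm_map, ← dist_eq_norm]

/-! ### Abstract Kriete–Trutt measures have no atom at `1` -/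

theorem IsKrieteTruttMeasure.ae_norm_le {μ : Measure ℂ} (hμ : IsKrieteTruttMeasure μ) :
    ∀ᵐ z ∂μ, ‖z‖ ≤ 1 := by
  rw [ae_iff]
  convert hμ.support using 2
  ext z
  simp

theorem IsKrieteTruttMeasure.integrable {μ : Measure ℂ} (hμ : IsKrieteTruttMeasure μ)
    (p : Polynomial ℂ) : Integrable (fun z => ‖p.eval z‖ ^ 2) μ := by
  have := hμ.finite
  have hc : Continuous fun z : ℂ => ‖p.eval z‖ ^ 2 := p.continuous.norm.pow 2
  obtain ⟨C, hC⟩ := (isCompact_closedBall (0 : ℂ) 1).exists_bound_of_continuousOn hc.continuousOn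
  refine Integrable.of_bound hc.aestronglyMeasurable C ?_
  filter_upwards [hμ.ae_norm_le] with z hz
  exact hC z (by simpa using hz)

/-- A polynomial with `p(1) = 1` gives `μ {1} ≤ ∫ |p|² dμ`, and the norm property makes the right
side as small as desired. -/
theorem IsKrieteTruttMeasure.ae_ne_one {μ : Measure ℂ} (hμ : IsKrieteTruttMeasure μ) :
    ∀ᵐ z ∂μ, z ≠ 1 := by
  have := hμ.finite
  have hle : ∀ ε : ℝ, 0 < ε → μ.real {1} ≤ ε := by
    intro ε hε
    obtain ⟨p, f, hpf, hp1, hf⟩ := exists_polynomial_norm_lt (Real.sqrt_pos.2 hε)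
    have h1 : ∫ z in {1}, ‖p.eval z‖ ^ 2 ∂μ ≤ ∫ z, ‖p.eval z‖ ^ 2 ∂μ :=
      setIntegral_le_integral (hμ.integrable p) (Filter.Eventually.of_forall fun _ => by positivity)
    rw [integral_singleton, hp1, hμ.norm_eq p f hpf] at h1
    simp at h1
    exact h1.trans ((Real.lt_sqrt (norm_nonneg _)).1 hf).le
  have h0 : μ.real {1} = 0 := le_antisymm (le_of_forall_pos_le_add fun ε hε => by
    simpa using hle ε hε) measureReal_nonneg
  rw [ae_iff]
  simpa [measureReal_eq_zero_iff] using h0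

end Cesaro

end

theorem mainTheorem10 :
    (∀ M : Submodule ℂ Cesaro.H2, IsClosed (M : Set Cesaro.H2) →
      (∀ f ∈ M, ∃ g ∈ M, ∀ z ∈ Cesaro.disk, g z = Cesaro.cesaro f z) →
      closure (Cesaro.cesaroImage (M : Set Cesaro.H2)) = (M : Set Cesaro.H2)) ∧
    (∀ N : Submodule ℂ (MeasureTheory.Lp ℂ 2 Cesaro.krieteTruttMeasure),
      Cesaro.IsClosedShiftInvariant Cesaro.krieteTruttMeasure N →
      closure (Cesaro.mulImage Cesaro.krieteTruttMeasure (fun z => 1 - z) (N : Set _)) =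
        (N : Set (MeasureTheory.Lp ℂ 2 Cesaro.krieteTruttMeasure))) ∧
    (∀ μ : MeasureTheory.Measure ℂ, Cesaro.IsKrieteTruttMeasure μ →
      ∀ N : Submodule ℂ (MeasureTheory.Lp ℂ 2 μ), Cesaro.IsClosedShiftInvariant μ N →
      closure (Cesaro.mulImage μ (fun z => 1 - z) (N : Set _)) =
        (N : Set (MeasureTheory.Lp ℂ 2 μ))) := by
  exact ⟨fun M hM hinv => Cesaro.closure_cesaroImage_eq M hM hinv,
    fun N hN => Cesaro.closure_mulImage_eq Cesaro.ae_norm_le_krieteTruttMeasure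
      Cesaro.ae_ne_one_krieteTruttMeasure N hN,
    fun _ hμ N hN => Cesaro.closure_mulImage_eq hμ.ae_norm_le hμ.ae_ne_one N hN⟩
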